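/- Let $D_{\mathbb R}[0,\infty)$ be the set of all functions $x:[0,\infty)\to\mathbb R$ that are right continuous and have left limits, equipped with the Skorokhod ($J_1$) topology and its Borel $\sigma$-algebra. For $t\ge 0$ let $\theta_t:D_{\mathbb R}[0,\infty)\to D_{\mathbb R}[0,\infty)$ be the stopping map $(\theta_t x)(s)=x(s\wedge t)$. A *filtrated Borel space* $(E,\mathcal F,\{\theta_t\}_{t\ge 0})$ is a standard Borel space $(E,\mathcal F)$ with measurable maps $\theta_t:E\to E$ satisfying $\theta_t\circ\theta_s=\theta_{s\wedge t}$ for all $s,t\ge 0$. Put $E_t=\{e\in E:\theta_t(e)=e\}$ with the trace $\sigma$-algebra, and for $s<t$ let $\theta_{st}:E_t\to E_s$ be the map $e\mapsto\theta_s(e)$. The space is *complete* if the natural measurable map $$E\to\varprojlim_t E_t=\Big\{(e_t)_{t\ge0}\in\prod_{t\ge 0}E_t:\ \theta_{st}(e_t)=e_s\text{ for all }s<t\Big\},\qquad e\mapsto(\theta_t(e))_{t\ge 0},$$ is bijective. **Proposition.** Let $M[0,\infty)$ be the set of non-decreasing functions in $D_{\mathbb R}[0,\infty)$, and let $BV[0,\infty)$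 be the set of functions in $D_{\mathbb R}[0,\infty)$ that are of bounded variation, i.e. of finite total variation on every compact interval $[0,t]$, $t\ge0$. Then $M[0,\infty)$ and $BV[0,\infty)$ are Borel subsets of $D_{\mathbb R}[0,\infty)$. Moreover, each $\theta_t$ maps $M[0,\infty)$ into itself and $BV[0,\infty)$ into itself, and with the trace $\sigma$-algebras and the restrictions of the maps $\theta_t$, both $M[0,\infty)$ and $BV[0,\infty)$ are complete filtrated Borel spaces. -/

import Mathlib

open Set Filter Topology MeasureTheory
open scoped NNReal

/-! ### Filtrated Borel spaces -/

/-- A family of self-maps `θ t`, `t ≥ 0`, makes a measurable space `E` a filtrated Borel space: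
`E` is standard Borel, every `θ t` is measurable, and `θ t ∘ θ s = θ (s ∧ t)`. -/
structure IsFiltratedBorelSpace {E : Type*} [MeasurableSpace E] (θ : ℝ≥0 → E → E) : Prop where
  standardBorel : StandardBorelSpace E
  measurable : ∀ t, Measurable (θ t)
  comp_eq : ∀ s t, θ t ∘ θ s = θ (min s t)

namespace IsFiltratedBorelSpace

variable {E : Type*} [MeasurableSpace E] {θ : ℝ≥0 → E → E}

theorem isFixedPt (hθ : IsFiltratedBorelSpace θ) (t : ℝ≥0) (e : E) :
    θ t e ∈ Function.fixedPoints (θ t) := by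
  have h := congrFun (hθ.comp_eq t t) e
  rw [min_self] at h
  exact h

/-- The map `E → E_t` induced by `θ t`, where `E_t = Fix (θ t)` carries the trace σ-algebra. -/
def toFix (hθ : IsFiltratedBorelSpace θ) (t : ℝ≥0) (e : E) : Function.fixedPoints (θ t) :=
  ⟨θ t e, hθ.isFixedPt t e⟩

/-- The transition map `θ_{st} : E_t → E_s` induced by `θ s`. -/
def transition (hθ : IsFiltratedBorelSpace θ) (s t : ℝ≥0) (e : Function.fixedPoints (θ t)) :
    Function.fixedPoints (θ s) :=
  hθ.toFix s e

/-- The projective limit of the spaces `E_t` along the transition maps, as a subspace of the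
product `∏ t, E_t` (with the trace of the product σ-algebra). -/
def projLimit (hθ : IsFiltratedBorelSpace θ) : Set (∀ t, Function.fixedPoints (θ t)) :=
  {e | ∀ s t, s < t → hθ.transition s t (e t) = e s}

theorem toFix_mem_projLimit (hθ : IsFiltratedBorelSpace θ) (e : E) :
    (fun t => hθ.toFix t e) ∈ hθ.projLimit := by
  intro s t hst
  apply Subtype.ext
  have h := congrFun (hθ.comp_eq t s) e
  rw [min_eq_right hst.le] at h
  exact h

/-- The natural map `E → lim E_t` whose components are the maps `E → E_t`. -/
def toProjLimit (hθ : IsFiltratedBorelSpace θ) (e : E) : hθ.projLimit :=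
  ⟨fun t => hθ.toFix t e, hθ.toFix_mem_projLimit e⟩

theorem measurable_toProjLimit (hθ : IsFiltratedBorelSpace θ) : Measurable hθ.toProjLimit :=
  (measurable_pi_lambda _ fun t => (hθ.measurable t).subtype_mk).subtype_mk

end IsFiltratedBorelSpace

/-- A filtrated Borel space is complete if the natural map to the projective limit of the
fixed point spaces `E_t` is bijective. -/
def IsCompleteFiltratedBorelSpace {E : Type*} [MeasurableSpace E] (θ : ℝ≥0 → E → E) : Prop :=
  ∃ hθ : IsFiltratedBorelSpace θ, Function.Bijective hθ.toProjLimit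

/-! ### The Skorokhod space -/

/-- The set `D_E[0,∞)` of paths `[0,∞) → E` that are right continuous and have left limits. -/
@[ext]
structure SkorokhodSpace (E : Type*) [MetricSpace E] where
  toFun : ℝ≥0 → E
  right_continuous : ∀ t, ContinuousWithinAt toFun (Ici t) t
  left_limits : ∀ t, ∃ l, Tendsto toFun (𝓝[<] t) (𝓝 l)

namespace SkorokhodSpace

variable {E : Type*} [MetricSpace E]

instance : CoeFun (SkorokhodSpace E) (fun _ => ℝ≥0 → E) := ⟨toFun⟩

/-- The basic Skorokhod neighbourhood of `x`: paths that are, on `[0,T]`, uniformly `ε`-close to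
`x` after a strictly increasing bijective time change of `[0,∞)` that is `ε`-close to the
identity on `[0,T]`. -/
def basicNhd (x : SkorokhodSpace E) (T : ℝ≥0) (ε : ℝ) : Set (SkorokhodSpace E) :=
  {y | ∃ τ : ℝ≥0 ≃o ℝ≥0, ∀ t ≤ T, dist (τ t) t < ε ∧ dist (y t) (x (τ t)) < ε}

theorem basicNhd_subset (x : SkorokhodSpace E) {T T' : ℝ≥0} {ε ε' : ℝ} (hT : T' ≤ T)
    (hε : ε ≤ ε') : x.basicNhd T ε ⊆ x.basicNhd T' ε' := by
  rintro y ⟨τ, h⟩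
  exact ⟨τ, fun t ht => ⟨(h t (ht.trans hT)).1.trans_le hε, (h t (ht.trans hT)).2.trans_le hε⟩⟩

/-- The Skorokhod (J1) topology on `D_E[0,∞)`. A sequence `x n` converges to `x` in it iff for
every `T` there are time changes `τ n` with `sup_{t ≤ T} |τ n t - t| → 0` and
`sup_{t ≤ T} dist (x n t) (x (τ n t)) → 0`. -/
instance : TopologicalSpace (SkorokhodSpace E) where
  IsOpen U := ∀ x ∈ U, ∃ T : ℝ≥0, ∃ ε > 0, x.basicNhd T ε ⊆ U
  isOpen_univ := fun _ _ => ⟨0, 1, one_pos, subset_univ _⟩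
  isOpen_inter := by
    rintro U V hU hV x ⟨hxU, hxV⟩
    obtain ⟨T, ε, hε, h⟩ := hU x hxU
    obtain ⟨T', ε', hε', h'⟩ := hV x hxV
    exact ⟨max T T', min ε ε', lt_min hε hε', subset_inter
      ((x.basicNhd_subset (le_max_left _ _) (min_le_left _ _)).trans h)
      ((x.basicNhd_subset (le_max_right _ _) (min_le_right _ _)).trans h')⟩
  isOpen_sUnion := by
    rintro S hS x ⟨U, hU, hxU⟩
    obtain ⟨T, ε, hε, h⟩ := hS U hU x hxU
    exact ⟨T, ε, hε, h.trans (subset_sUnion_of_mem hU)⟩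

instance : MeasurableSpace (SkorokhodSpace E) := borel _

instance : BorelSpace (SkorokhodSpace E) := ⟨rfl⟩

/-- The stopping map `θ t : x ↦ x (· ∧ t)` on `D_E[0,∞)`. -/
def stopAt (t : ℝ≥0) (x : SkorokhodSpace E) : SkorokhodSpace E where
  toFun s := x (min s t)
  right_continuous u := by
    refine (x.right_continuous (min u t)).comp (t := Ici (min u t)) (f := fun s => min s t)
      (by fun_prop) ?_
    intro s hs
    exact min_le_min_right t hs
  left_limits u := by
    rcases le_or_gt u t with hut | htu
    · obtain ⟨l, hl⟩ := x.left_limits u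
      refine ⟨l, hl.congr' ?_⟩
      filter_upwards [self_mem_nhdsWithin] with s hs
      rw [min_eq_left ((le_of_lt hs).trans hut)]
    · refine ⟨x t, tendsto_const_nhds.congr' ?_⟩
      filter_upwards [mem_nhdsWithin_of_mem_nhds (Ioi_mem_nhds htu)] with s hs
      rw [min_eq_right (le_of_lt hs)]

/-- `M[0,∞)`: the non-decreasing paths in `D_ℝ[0,∞)`. -/
def nondecreasing : Set (SkorokhodSpace ℝ) := {x | Monotone x.toFun}

/-- `BV[0,∞)`: the paths in `D_ℝ[0,∞)` that are of bounded variation, that is, of finite total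
variation on every compact interval. -/
def boundedVariation : Set (SkorokhodSpace ℝ) := {x | LocallyBoundedVariationOn x.toFun univ}

end SkorokhodSpace

/-! A right-continuous path is determined by its values at rational times, so the problem can be
moved to the Polish space of real functions on `NNRat`.

The J1 Borel σ-algebra is generated by the rational evaluations (`borel_eq_comap_ratRestrict`). An
open set is a countable union of sets that prescribe, on a fine grid, an approximation by rational
values with one jump per cell. Two paths sharing such data are Skorokhod-close, because a piecewise
linear time change aligns their jumps.

The rational traces of paths in BV are exactly the functions on `NNRat` that are locally of bounded
variation and right continuous at each rational (`exists_ratRestrict_eq`): split such a function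
into two monotone ones, extend each by right limits and subtract. These are measurable conditions,
so BV is Borel isomorphic to a Borel subset of a countable power of the line, hence standard Borel
without any appeal to D being Polish. M is a measurable part of BV.

Completeness holds because membership in either set is decided by the stopped paths, and a
compatible family of stopped paths is glued along the diagonal (`glue`). -/

namespace SkorokhodSpace

/-! ### Measurability of evaluations, and rational traces -/

theorem isOpen_iff {E : Type*} [MetricSpace E] {U : Set (SkorokhodSpace E)} :
    IsOpen U ↔ ∀ x ∈ U, ∃ T : ℝ≥0, ∃ ε > 0, x.basicNhd T ε ⊆ U := Iff.rfl

theorem isOpen_setOf_exists_lt (a b : ℝ≥0) (c : ℝ) :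
    IsOpen {x : SkorokhodSpace ℝ | ∃ t, a < t ∧ t < b ∧ c < x t} := by
  rw [isOpen_iff]
  rintro x ⟨t, hat, htb, hct⟩
  have hat' : (a : ℝ) < t := hat
  have htb' : (t : ℝ) < b := htb
  refine ⟨b, min (x t - c) (min (t - a) (b - t)),
    lt_min (sub_pos.2 hct) (lt_min (sub_pos.2 hat') (sub_pos.2 htb')), ?_⟩
  rintro y ⟨τ, h⟩
  -- The closeness bounds are available only up to time `b`, so the bound at `b` itself must first
  -- place `τ.symm t` in that range.
  have hub : τ.symm t ≤ b := by
    rw [OrderIso.symm_apply_le]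
    have h1 := (h b le_rfl).1
    rw [NNReal.dist_eq, abs_lt] at h1
    have h2 : min (x t - c) (min ((t : ℝ) - a) (b - t)) ≤ b - t :=
      (min_le_right _ _).trans (min_le_right _ _)
    have : (t : ℝ) ≤ τ b := by linarith [h1.1]
    exact this
  obtain ⟨h1, h2⟩ := h _ hub
  rw [OrderIso.apply_symm_apply] at h1 h2
  rw [NNReal.dist_eq] at h1
  rw [Real.dist_eq] at h2
  simp only [lt_min_iff, abs_lt] at h1 h2
  refine ⟨τ.symm t, ?_, ?_, by linarith⟩
  · have : (a : ℝ) < τ.symm t := by linarith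
    exact this
  · have : (τ.symm t : ℝ) < b := by linarith
    exact this

theorem exists_pos_forall_abs_sub_lt (x : SkorokhodSpace ℝ) (t : ℝ≥0) {ε : ℝ} (hε : 0 < ε) :
    ∃ u, t < u ∧ ∀ s, t ≤ s → s < u → |x s - x t| < ε := by
  have h := x.right_continuous t (Metric.ball_mem_nhds (x t) hε)
  rw [mem_map, mem_nhdsGE_iff_exists_Ico_subset] at h
  obtain ⟨u, hu, h⟩ := h
  exact ⟨u, hu, fun s hs hsu => by simpa [Real.dist_eq] using h ⟨hs, hsu⟩⟩

theorem measurable_eval (t : ℝ≥0) : Measurable fun x : SkorokhodSpace ℝ => x t := by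
  refine measurable_of_Iic fun c => ?_
  -- Time changes move a fixed time, so the value at `t` is reached through right continuity, as the
  -- limit of suprema over shrinking open intervals to the right of `t`.
  have : (fun x : SkorokhodSpace ℝ => x t) ⁻¹' Iic c = ⋂ k : ℕ, ⋃ m : ℕ,
      {x : SkorokhodSpace ℝ | ∃ s, t < s ∧ s < t + 1 / ((m : ℝ≥0) + 1) ∧
        c + 1 / ((k : ℝ) + 1) < x s}ᶜ := by
    ext x
    simp only [mem_preimage, mem_Iic, mem_iInter, mem_iUnion, mem_compl_iff, mem_ofPred_eq,
      not_exists, not_and, not_lt]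
    constructor
    · intro hx k
      obtain ⟨u, htu, hu⟩ := x.exists_pos_forall_abs_sub_lt t
        (Nat.one_div_pos_of_nat (α := ℝ) (n := k))
      obtain ⟨m, hm⟩ := exists_nat_one_div_lt (tsub_pos_of_lt htu)
      refine ⟨m, fun s hts hs => ?_⟩
      have := hu s hts.le (hs.trans (by rwa [lt_tsub_iff_left] at hm))
      linarith [(abs_lt.1 this).2]
    · intro h
      by_contra! hc
      obtain ⟨k, hk⟩ := exists_nat_one_div_lt (half_pos (sub_pos.2 hc))
      obtain ⟨m, hm⟩ := h k
      obtain ⟨u, htu, hu⟩ := x.exists_pos_forall_abs_sub_lt t (half_pos (sub_pos.2 hc))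
      obtain ⟨s, hts, hs⟩ := exists_between
        (lt_min htu (lt_add_of_pos_right t (Nat.one_div_pos_of_nat (α := ℝ≥0) (n := m))))
      have h1 := hm s hts (hs.trans_le (min_le_right _ _))
      have h2 := hu s hts.le (hs.trans_le (min_le_left _ _))
      linarith [(abs_lt.1 h2).1]
  rw [this]
  exact .iInter fun k => .iUnion fun m => (isOpen_setOf_exists_lt _ _ _).measurableSet.compl

/-- The restriction of a path to rational times. -/
def ratRestrict (x : SkorokhodSpace ℝ) (q : NNRat) : ℝ := x (q : ℝ≥0)

theorem measurable_ratRestrict : Measurable ratRestrict :=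
  measurable_pi_lambda _ fun q => measurable_eval q

theorem exists_nnrat_btwn {a b : ℝ≥0} (h : a < b) : ∃ q : NNRat, a < q ∧ (q : ℝ≥0) < b := by
  have h' : (a : ℝ) < b := h
  obtain ⟨q, h1, h2⟩ := exists_rat_btwn h'
  have hq : 0 ≤ q := by exact_mod_cast a.2.trans h1.le
  lift q to NNRat using hq
  exact ⟨q, by exact_mod_cast h1, by exact_mod_cast h2⟩

theorem exists_nnrat_mem_of_isOpen {x : SkorokhodSpace ℝ} {t : ℝ≥0} {U : Set ℝ} (hU : IsOpen U)
    (h : x t ∈ U) {b : ℝ≥0} (hb : t < b) : ∃ q : NNRat, t < q ∧ (q : ℝ≥0) < b ∧ x q ∈ U := by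
  have h := x.right_continuous t (hU.mem_nhds h)
  rw [mem_map, mem_nhdsGE_iff_exists_Ico_subset] at h
  obtain ⟨u, hu, h⟩ := h
  obtain ⟨q, h1, h2⟩ := exists_nnrat_btwn (lt_min (mem_Ioi.1 hu) hb)
  exact ⟨q, h1, h2.trans_le (min_le_right _ _), h ⟨h1.le, h2.trans_le (min_le_left _ _)⟩⟩

theorem ratRestrict_injective : Function.Injective ratRestrict := by
  intro x y h
  ext t
  by_contra hne
  obtain ⟨U, V, hU, hV, hxU, hyV, hUV⟩ := t2_separation hne
  have h1 := x.right_continuous t (hU.mem_nhds hxU)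
  have h2 := y.right_continuous t (hV.mem_nhds hyV)
  have h3 := inter_mem (mem_map.1 h1) (mem_map.1 h2)
  rw [mem_nhdsGE_iff_exists_Ico_subset] at h3
  obtain ⟨u, hu, h3⟩ := h3
  obtain ⟨q, h4, h5⟩ := exists_nnrat_btwn (mem_Ioi.1 hu)
  obtain ⟨h6, h7⟩ := h3 ⟨h4.le, h5⟩
  have h8 : x q = y q := congrFun h q
  exact hUV.le_bot ⟨h6, by rw [h8]; exact h7⟩

/-! ### Paths with one jump per cell, tested at rational times -/

/-- The paths that, on `[d, d')`, are uniformly `ε`-close to a step function with values `v`, `v'`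
and a single interior jump. -/
def oneJumpOn (d d' : ℝ≥0) (ε : ℝ) (v v' : ℝ) : Set (SkorokhodSpace ℝ) :=
  {x | ∃ s, d < s ∧ s < d' ∧ (∀ t, d ≤ t → t < s → |x t - v| ≤ ε) ∧
    ∀ t, s ≤ t → t < d' → |x t - v'| ≤ ε}

/-- The last clause puts every rational time far from `v'` at or before every rational time far from
`v`, so a jump time separating them exists; `p` and `r` keep it strictly inside the cell. -/
theorem mem_oneJumpOn_iff {d d' : ℝ≥0} {ε v v' : ℝ} {x : SkorokhodSpace ℝ} :
    x ∈ oneJumpOn d d' ε v v' ↔ ∃ p r : NNRat, d < p ∧ p ≤ r ∧ (r : ℝ≥0) < d' ∧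
      ∀ q q' : NNRat, d ≤ q → (q : ℝ≥0) < d' → d ≤ q' → (q' : ℝ≥0) < d' →
        (|x q - v| ≤ ε ∨ p ≤ q) ∧ (|x q' - v'| ≤ ε ∨ q' ≤ r) ∧
          (|x q - v| ≤ ε ∨ |x q' - v'| ≤ ε ∨ q' ≤ q) := by
  constructor
  · rintro ⟨s, hds, hsd, h1, h2⟩
    obtain ⟨p, hdp, hps⟩ := exists_nnrat_btwn hds
    obtain ⟨r, hsr, hrd⟩ := exists_nnrat_btwn hsd
    refine ⟨p, r, hdp, by exact_mod_cast (hps.trans hsr).le, hrd, fun q q' hq hq' hr hr' => ?_⟩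
    have hq1 : |x q - v| ≤ ε ∨ s ≤ q := (lt_or_ge (q : ℝ≥0) s).imp_left (h1 q hq)
    have hq2 : |x q' - v'| ≤ ε ∨ (q' : ℝ≥0) < s := (le_or_gt s (q' : ℝ≥0)).imp_left (h2 q' · hr')
    refine ⟨hq1.imp_right fun h => by exact_mod_cast hps.le.trans h,
      hq2.imp_right fun h => by exact_mod_cast (h.trans hsr).le, ?_⟩
    rcases hq1 with h | h
    · exact .inl h
    rcases hq2 with h' | h'
    · exact .inr (.inl h')
    · exact .inr (.inr (by exact_mod_cast (h'.trans_le h).le))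
  · rintro ⟨p, r, hdp, hpr, hrd, h⟩
    have hpr' : (p : ℝ≥0) ≤ r := by exact_mod_cast hpr
    -- The jump time is the supremum of the rational times far from `v'`. Inserting `p` makes the
    -- set nonempty and keeps the supremum above `d`.
    set C : Set ℝ≥0 := insert (p : ℝ≥0)
      {t | ∃ q : NNRat, (q : ℝ≥0) = t ∧ d ≤ t ∧ t < d' ∧ ε < |x t - v'|} with hC
    have hne : C.Nonempty := ⟨p, mem_insert _ _⟩
    have hCr : ∀ t ∈ C, t ≤ r := by
      rintro t (rfl | ⟨q, rfl, h1, h2, h3⟩)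
      · exact hpr'
      · exact_mod_cast ((h q q h1 h2 h1 h2).2.1.resolve_left h3.not_ge)
    have hbdd : BddAbove C := ⟨r, hCr⟩
    have hps : (p : ℝ≥0) ≤ sSup C := le_csSup hbdd (mem_insert _ _)
    have hsr : sSup C ≤ r := csSup_le hne hCr
    refine ⟨sSup C, hdp.trans_le hps, hsr.trans_lt hrd, fun t hdt hts => ?_, fun t hst htd => ?_⟩
    · by_contra! hlt
      obtain ⟨q, htq, hqs, hq⟩ := exists_nnrat_mem_of_isOpen (x := x) (U := {z | ε < |z - v|})
        (isOpen_lt continuous_const (by fun_prop)) hlt hts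
      have hdq := hdt.trans htq.le
      have hqd := hqs.trans (hsr.trans_lt hrd)
      refine hqs.not_ge (csSup_le hne ?_)
      rintro u (rfl | ⟨q', rfl, h1, h2, h3⟩)
      · exact_mod_cast (h q q hdq hqd hdq hqd).1.resolve_left (not_le.2 hq)
      · exact_mod_cast ((h q q' hdq hqd h1 h2).2.2.resolve_left (not_le.2 hq)).resolve_left h3.not_ge
    · by_contra! hlt
      obtain ⟨q, htq, hqs, hq⟩ := exists_nnrat_mem_of_isOpen (x := x) (U := {z | ε < |z - v'|})
        (isOpen_lt continuous_const (by fun_prop)) hlt htd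
      refine (hst.trans_lt htq).not_ge (le_csSup hbdd (.inr ⟨q, rfl, ?_, hqs, hq⟩))
      exact hdp.le.trans (hps.trans (hst.trans htq.le))

theorem measurableSet_oneJumpOn (d d' : ℝ≥0) (ε v v' : ℝ) :
    MeasurableSet[MeasurableSpace.comap ratRestrict inferInstance] (oneJumpOn d d' ε v v') := by
  let _ : MeasurableSpace (SkorokhodSpace ℝ) := MeasurableSpace.comap ratRestrict inferInstance
  have hev (q : NNRat) : Measurable fun x : SkorokhodSpace ℝ => x q :=
    (measurable_pi_apply q).comp (comap_measurable ratRestrict)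
  have hle (q : NNRat) (w : ℝ) : MeasurableSet {x : SkorokhodSpace ℝ | |x q - w| ≤ ε} :=
    measurableSet_le (((hev q).sub_const w).abs) measurable_const
  have : oneJumpOn d d' ε v v' = {x | _} := Set.ext fun x => mem_oneJumpOn_iff
  rw [this]
  simp only [ofPred_exists, ofPred_forall, ofPred_and, ofPred_or]
  refine .iUnion fun p => .iUnion fun r => (MeasurableSet.const _).inter <|
    (MeasurableSet.const _).inter <| (MeasurableSet.const _).inter <| .iInter fun q =>
    .iInter fun q' => .iInter fun _ => .iInter fun _ => .iInter fun _ => .iInter fun _ => ?_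
  exact ((hle q v).union (.const _)).inter <| ((hle q' v').union (.const _)).inter <|
    (hle q v).union ((hle q' v').union (.const _))

end SkorokhodSpace

/-! ### Piecewise linear time changes -/

theorem NNReal.exists_orderIso_apply_eq {d d' a b : ℝ≥0} (hda : d < a) (had : a < d')
    (hdb : d < b) (hbd : b < d') :
    ∃ φ : ℝ≥0 ≃o ℝ≥0, (∀ t ≤ d, φ t = t) ∧ (∀ t, d' ≤ t → φ t = t) ∧ φ a = b := by
  rw [← NNReal.coe_lt_coe] at hda had hdb hbd
  obtain ⟨k, hk, hka⟩ : ∃ k : ℝ, 0 < k ∧ (a - d) * k = b - d :=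
    ⟨(b - d) / (a - d), div_pos (sub_pos.2 hdb) (sub_pos.2 hda),
      mul_div_cancel₀ _ (sub_pos.2 hda).ne'⟩
  obtain ⟨m, hm, hma⟩ : ∃ m : ℝ, 0 < m ∧ (d' - a) * m = d' - b :=
    ⟨(d' - b) / (d' - a), div_pos (sub_pos.2 hbd) (sub_pos.2 had),
      mul_div_cancel₀ _ (sub_pos.2 had).ne'⟩
  let g : ℝ → ℝ := fun t => if t ≤ d then t else if t ≤ a then d + (t - d) * k else
    if t ≤ d' then d' - (d' - t) * m else t
  have g1 {t : ℝ} (h : t ≤ d) : g t = t := if_pos h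
  have g2 {t : ℝ} (h : d ≤ t) (h' : t ≤ a) : g t = d + (t - d) * k := by
    rcases h.eq_or_lt with rfl | h
    · simp [g]
    · simp [g, h.not_ge, h']
  have g3 {t : ℝ} (h : a ≤ t) (h' : t ≤ d') : g t = d' - (d' - t) * m := by
    rcases h.eq_or_lt with rfl | h
    · rw [g2 hda.le le_rfl]; linarith
    · simp [g, h.not_ge, h', (hda.trans h).not_ge]
  have g4 {t : ℝ} (h : d' ≤ t) : g t = t := by
    rcases h.eq_or_lt with rfl | h
    · rw [g3 had.le le_rfl]; ring
    · simp [g, h.not_ge, (had.trans h).not_ge, (hda.trans (had.trans h)).not_ge]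
  have hmono : StrictMono g := by
    refine StrictMonoOn.Iic_union_Ici (a := (a : ℝ)) (fun s hs t ht hst => ?_)
      fun s hs t ht hst => ?_
    · simp only [mem_Iic] at hs ht
      rcases le_total t d with h | h
      · rwa [g1 h, g1 (hst.le.trans h)]
      rcases le_total s d with h' | h'
      · rw [g1 h', g2 h ht]
        rcases h.eq_or_lt with rfl | h
        · simpa using hst
        · nlinarith [mul_pos (sub_pos.2 h) hk]
      · rw [g2 h' hs, g2 h ht]
        nlinarith
    · simp only [mem_Ici] at hs ht
      rcases le_total (d' : ℝ) s with h | h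
      · rwa [g4 h, g4 (h.trans hst.le)]
      rcases le_total (d' : ℝ) t with h' | h'
      · rw [g4 h', g3 hs h]
        rcases h.eq_or_lt with rfl | h
        · simpa using hst
        · nlinarith [mul_pos (sub_pos.2 h) hm]
      · rw [g3 hs h, g3 ht h']
        nlinarith
  have g0 : g 0 = 0 := g1 d.2
  have hpos (t : ℝ≥0) : 0 ≤ g t := by
    rw [← g0]
    exact hmono.monotone t.2
  have hsurj (y : ℝ) : ∃ t, g t = y := by
    rcases le_total y d with h | h
    · exact ⟨y, g1 h⟩
    rcases le_total (d' : ℝ) y with h' | h'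
    · exact ⟨y, g4 h'⟩
    rcases le_total y b with hb | hb
    · refine ⟨d + (y - d) / k, ?_⟩
      rw [g2]
      · field_simp; ring
      · have := div_nonneg (sub_nonneg.2 h) hk.le
        linarith
      · have : (y - d) / k ≤ a - d := by
          rw [div_le_iff₀ hk]; linarith
        linarith
    · refine ⟨d' - (d' - y) / m, ?_⟩
      rw [g3]
      · field_simp; ring
      · have : (d' - y) / m ≤ d' - a := by
          rw [div_le_iff₀ hm]; linarith
        linarith
      · have := div_nonneg (sub_nonneg.2 h') hm.le
        linarith
  let f : ℝ≥0 → ℝ≥0 := fun t => ⟨g t, hpos t⟩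
  have hf : StrictMono f := fun s t hst => hmono (NNReal.coe_lt_coe.2 hst)
  have hfs : Function.Surjective f := by
    intro y
    obtain ⟨t, ht⟩ := hsurj y
    have ht0 : 0 ≤ t := by
      rw [← hmono.le_iff_le, g0, ht]
      exact y.2
    exact ⟨⟨t, ht0⟩, Subtype.ext ht⟩
  refine ⟨hf.orderIsoOfSurjective f hfs, fun t ht => ?_, fun t ht => ?_, ?_⟩
  · exact Subtype.ext (g1 (NNReal.coe_le_coe.2 ht))
  · exact Subtype.ext (g4 (NNReal.coe_le_coe.2 ht))
  · refine Subtype.ext ((g2 hda.le le_rfl).trans ?_)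
    exact (congrArg (fun z => (d : ℝ) + z) hka).trans (add_sub_cancel _ _)

/-- One time change per cell is composed; each is the identity off its own cell, so it leaves the
earlier cells undisturbed. -/
theorem NNReal.exists_orderIso_of_partition {D a b : ℕ → ℝ≥0} (hD : Monotone D) (K : ℕ)
    (h : ∀ j < K, (D j < a j ∧ a j < D (j + 1)) ∧ D j < b j ∧ b j < D (j + 1)) :
    ∃ τ : ℝ≥0 ≃o ℝ≥0, (∀ t, D K ≤ t → τ t = t) ∧ ∀ j < K, τ (D j) = D j ∧ τ (a j) = b j := by
  induction K with
  | zero => exact ⟨OrderIso.refl _, fun _ _ => rfl, by simp⟩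
  | succ K ih =>
    obtain ⟨τ, h1, h2⟩ := ih fun j hj => h j (hj.trans K.lt_succ_self)
    obtain ⟨⟨h3, h4⟩, h5, h6⟩ := h K K.lt_succ_self
    obtain ⟨φ, h7, h8, h9⟩ := NNReal.exists_orderIso_apply_eq h3 h4 h5 h6
    refine ⟨τ.trans φ, fun t ht => ?_, fun j hj => ?_⟩
    · rw [OrderIso.trans_apply, h1 t ((hD K.le_succ).trans ht), h8 t ht]
    rw [OrderIso.trans_apply, OrderIso.trans_apply]
    rcases Nat.lt_succ_iff_lt_or_eq.1 hj with hj | rfl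
    · obtain ⟨h10, h11⟩ := h2 j hj
      rw [h10, h11]
      exact ⟨h7 _ (hD hj.le), h7 _ ((h j (hj.trans K.lt_succ_self)).2.2.le.trans (hD hj))⟩
    · rw [h1 _ le_rfl, h1 _ h3.le]
      exact ⟨h7 _ le_rfl, h9⟩

/-! ### Rational evaluations generate the Borel σ-algebra -/

namespace SkorokhodSpace

theorem exists_lt_mem_Ico {α : Type*} [LinearOrder α] (D : ℕ → α) {K : ℕ} {t : α} (h0 : D 0 ≤ t)
    (hK : t < D K) : ∃ j < K, D j ≤ t ∧ t < D (j + 1) := by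
  induction K with
  | zero => exact absurd hK h0.not_gt
  | succ K ih =>
    rcases lt_or_ge t (D K) with h | h
    · obtain ⟨j, hj, h⟩ := ih h
      exact ⟨j, hj.trans K.lt_succ_self, h⟩
    · exact ⟨K, K.lt_succ_self, h, hK⟩

/-- Take the time change that fixes the grid points and sends the jumps of `y` to those of `x`.
Times stay in their cell, and values on matching sides of the jumps differ by at most `2 * ε`. -/
theorem mem_basicNhd_of_mem_oneJumpOn {D : ℕ → ℝ≥0} (hD : Monotone D) (h0 : D 0 = 0) {K : ℕ}
    {T : ℝ≥0} (hT : T < D K) {δ ε : ℝ} (hδ : ∀ j < K, (D (j + 1) : ℝ) - D j < δ) (hε : 2 * ε < δ)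
    {v v' : Fin K → ℝ} {x y : SkorokhodSpace ℝ}
    (hx : ∀ j : Fin K, x ∈ oneJumpOn (D j) (D (j + 1)) ε (v j) (v' j))
    (hy : ∀ j : Fin K, y ∈ oneJumpOn (D j) (D (j + 1)) ε (v j) (v' j)) :
    y ∈ x.basicNhd T δ := by
  choose b hb using hx
  choose a ha using hy
  let a' : ℕ → ℝ≥0 := fun j => if h : j < K then a ⟨j, h⟩ else 0
  let b' : ℕ → ℝ≥0 := fun j => if h : j < K then b ⟨j, h⟩ else 0
  have ha' (j : Fin K) : a' j = a j := dif_pos j.2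
  have hb' (j : Fin K) : b' j = b j := dif_pos j.2
  obtain ⟨τ, h1, h2⟩ := NNReal.exists_orderIso_of_partition (a := a') (b := b') hD K (by
    intro j hj
    have h1 := ha ⟨j, hj⟩
    have h2 := hb ⟨j, hj⟩
    rw [← ha'] at h1
    rw [← hb'] at h2
    exact ⟨⟨h1.1, h1.2.1⟩, h2.1, h2.2.1⟩)
  refine ⟨τ, fun t ht => ?_⟩
  obtain ⟨j, hj, hjt, htj⟩ := exists_lt_mem_Ico D (h0.trans_le zero_le) (ht.trans_lt hT)
  have e1 : τ (D j) = D j := (h2 j hj).1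
  have e2 : τ (D (j + 1)) = D (j + 1) := by
    rcases lt_or_ge (j + 1) K with h | h
    · exact (h2 _ h).1
    · exact h1 _ (hD h)
  have e3 : τ (a ⟨j, hj⟩) = b ⟨j, hj⟩ := by
    rw [← ha', ← hb']
    exact (h2 j hj).2
  have l1 : D j ≤ τ t := by rw [← e1]; exact τ.monotone hjt
  have l2 : τ t < D (j + 1) := by rw [← e2]; exact τ.strictMono htj
  constructor
  · have := hδ j hj
    rw [NNReal.dist_eq, abs_lt]
    rw [← NNReal.coe_le_coe] at hjt l1
    rw [← NNReal.coe_lt_coe] at htj l2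
    constructor <;> linarith
  · rw [Real.dist_eq]
    obtain ⟨-, -, a1, a2⟩ := ha ⟨j, hj⟩
    obtain ⟨-, -, b1, b2⟩ := hb ⟨j, hj⟩
    rcases lt_or_ge t (a ⟨j, hj⟩) with h | h
    · have h3 := abs_le.1 (a1 t hjt h)
      have h4 := abs_le.1 (b1 (τ t) l1 (by rw [← e3]; exact τ.strictMono h))
      rw [abs_lt]
      constructor <;> linarith [h3.1, h3.2, h4.1, h4.2]
    · have h3 := abs_le.1 (a2 t h htj)
      have h4 := abs_le.1 (b2 (τ t) (by rw [← e3]; exact τ.monotone h) l2)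
      rw [abs_lt]
      constructor <;> linarith [h3.1, h3.2, h4.1, h4.2]

/-- Near each `u` the path is close to its left limit before `u` and to `x u` from `u` on. A
Lebesgue number of this cover makes every short cell see a single such `u`. -/
theorem exists_forall_mem_oneJumpOn (x : SkorokhodSpace ℝ) (T : ℝ≥0) {ε : ℝ} (hε : 0 < ε) :
    ∃ δ > 0, ∀ d ≤ T, ∀ d', d < d' → (d' : ℝ) < d + δ →
      ∃ v : ℚ × ℚ, x ∈ oneJumpOn d d' ε v.1 v.2 := by
  have key (u : ℝ≥0) : ∃ l : ℝ, ∀ᶠ t in 𝓝 u,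
      (t < u → |x t - l| < ε / 2) ∧ (u ≤ t → |x t - x u| < ε / 2) := by
    obtain ⟨l, hl⟩ := x.left_limits u
    refine ⟨l, ?_⟩
    have h1 := hl (Metric.ball_mem_nhds l (half_pos hε))
    have h2 := x.right_continuous u (Metric.ball_mem_nhds (x u) (half_pos hε))
    rw [mem_map, mem_nhdsWithin_iff_eventually] at h1 h2
    filter_upwards [h1, h2] with t h1 h2
    exact ⟨h1, h2⟩
  choose l hl using key
  obtain ⟨δ, hδ, h⟩ := lebesgue_number_lemma_of_metric (isCompact_Icc (a := (0 : ℝ≥0)) (b := T))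
    (c := fun u => interior {t | (t < u → |x t - l u| < ε / 2) ∧ (u ≤ t → |x t - x u| < ε / 2)})
    (fun _ => isOpen_interior)
    (fun u _ => mem_iUnion.2 ⟨u, mem_interior_iff_mem_nhds.2 (hl u)⟩)
  refine ⟨δ, hδ, fun d hd d' hdd hd' => ?_⟩
  obtain ⟨u, hu⟩ := h d ⟨zero_le, hd⟩
  replace hu (t : ℝ≥0) (h1 : d ≤ t) (h2 : t < d') := interior_subset <| hu (a := t) (by
    rw [Metric.mem_ball, NNReal.dist_eq, abs_lt]
    rw [← NNReal.coe_le_coe] at h1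
    rw [← NNReal.coe_lt_coe] at h2
    constructor <;> linarith)
  obtain ⟨v, hv⟩ := exists_rat_near (l u) (half_pos hε)
  obtain ⟨w, hw⟩ := exists_rat_near (x u) (half_pos hε)
  have hv' (t : ℝ≥0) (h1 : d ≤ t) (h2 : t < d') (h3 : t < u) : |x t - v| ≤ ε := by
    have := (hu t h1 h2).1 h3
    rw [abs_lt] at this hv
    rw [abs_le]
    constructor <;> linarith [this.1, this.2, hv.1, hv.2]
  have hw' (t : ℝ≥0) (h1 : d ≤ t) (h2 : t < d') (h3 : u ≤ t) : |x t - w| ≤ ε := by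
    have := (hu t h1 h2).2 h3
    rw [abs_lt] at this hw
    rw [abs_le]
    constructor <;> linarith [this.1, this.2, hw.1, hw.2]
  -- When `u` is not interior to the cell, one value serves both sides and the jump time `s` is
  -- arbitrary.
  obtain ⟨s, hds, hsd⟩ := exists_between hdd
  rcases le_or_gt u d with hud | hud
  · exact ⟨(w, w), s, hds, hsd, fun t h1 h2 => hw' t h1 (h2.trans hsd) (hud.trans h1),
      fun t h1 h2 => hw' t (hds.le.trans h1) h2 (hud.trans (hds.le.trans h1))⟩
  rcases le_or_gt d' u with hdu | hdu
  · exact ⟨(v, v), s, hds, hsd, fun t h1 h2 => hv' t h1 (h2.trans hsd) ((h2.trans hsd).trans_le hdu),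
      fun t h1 h2 => hv' t (hds.le.trans h1) h2 (h2.trans_le hdu)⟩
  · exact ⟨(v, w), u, hud, hdu, fun t h1 h2 => hv' t h1 (h2.trans hdu) h2,
      fun t h1 h2 => hw' t (hud.le.trans h1) h2 h1⟩

theorem borel_eq_comap_ratRestrict :
    borel (SkorokhodSpace ℝ) = MeasurableSpace.comap ratRestrict inferInstance := by
  refine le_antisymm (MeasurableSpace.generateFrom_le fun U hU => ?_)
    measurable_ratRestrict.comap_le
  let D (n j : ℕ) : ℝ≥0 := j / ((n : ℝ≥0) + 1)
  have hD (n : ℕ) : Monotone (D n) := fun i j hij => by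
    have : (i : ℝ≥0) ≤ j := by exact_mod_cast hij
    exact div_le_div_of_nonneg_right this zero_le
  have hDsucc (n j : ℕ) : D n (j + 1) = D n j + 1 / ((n : ℝ≥0) + 1) := by
    simp only [D, Nat.cast_succ, add_div]
  let B (n m N : ℕ) (v : Fin (N * (n + 1)) → ℚ × ℚ) : Set (SkorokhodSpace ℝ) :=
    ⋂ j : Fin (N * (n + 1)), oneJumpOn (D n j) (D n (j + 1)) (1 / ((m : ℝ) + 1)) (v j).1 (v j).2
  have hB (n m N : ℕ) (v) : MeasurableSet[MeasurableSpace.comap ratRestrict inferInstance]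
      (B n m N v) := by
    refine @MeasurableSet.iInter _ _ (_) _ _ fun j => measurableSet_oneJumpOn _ _ _ _ _
  -- All indices, including the finite rational tuples `v`, range over countable sets.
  have hU' : U = ⋃ n, ⋃ m, ⋃ N, ⋃ v, ⋃ _ : B n m N v ⊆ U, B n m N v := by
    refine subset_antisymm (fun x hx => ?_) (by simp)
    obtain ⟨T, ε, hε, hsub⟩ := isOpen_iff.1 hU x hx
    obtain ⟨N, hN⟩ := exists_nat_gt T
    obtain ⟨m, hm⟩ := exists_nat_one_div_lt (half_pos hε)
    obtain ⟨δ, hδ, h⟩ := x.exists_forall_mem_oneJumpOn N (Nat.one_div_pos_of_nat (α := ℝ) (n := m))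
    -- Mesh below `ε` controls the time displacement; mesh below `δ` gives one jump per cell.
    obtain ⟨n, hn⟩ := exists_nat_one_div_lt (lt_min hε hδ)
    rw [lt_min_iff] at hn
    have hDN : D n (N * (n + 1)) = N := by
      simp only [D]
      push_cast
      exact mul_div_cancel_right₀ _ (by positivity)
    have hDs (j : ℕ) : (D n (j + 1) : ℝ) = D n j + 1 / ((n : ℝ) + 1) := by
      rw [hDsucc]; push_cast; rfl
    have hjump (j : Fin (N * (n + 1))) : ∃ v : ℚ × ℚ,
        x ∈ oneJumpOn (D n j) (D n (j + 1)) (1 / ((m : ℝ) + 1)) v.1 v.2 := by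
      refine h _ ((hD n j.2.le).trans hDN.le) _ ?_ (by rw [hDs]; linarith)
      rw [hDsucc]
      exact lt_add_of_pos_right _ Nat.one_div_pos_of_nat
    choose v hv using hjump
    simp only [mem_iUnion]
    refine ⟨n, m, N, v, fun y hy => hsub ?_, mem_iInter.2 hv⟩
    exact mem_basicNhd_of_mem_oneJumpOn (hD n) (by simp [D]) (hN.trans_eq hDN.symm)
      (fun j _ => by rw [hDs]; linarith) (by linarith) hv (mem_iInter.1 hy)
  rw [hU']
  let _ : MeasurableSpace (SkorokhodSpace ℝ) := MeasurableSpace.comap ratRestrict inferInstance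
  exact .iUnion fun n => .iUnion fun m => .iUnion fun N => .iUnion fun v => .iUnion fun _ =>
    hB n m N v

end SkorokhodSpace

/-! ### Variation: differences, monotone reparametrisation, measurability -/

theorem eVariationOn.sub_le {α E : Type*} [LinearOrder α] [SeminormedAddCommGroup E] (f g : α → E)
    (s : Set α) : eVariationOn (f - g) s ≤ eVariationOn f s + eVariationOn g s := by
  refine iSup_le fun p => ?_
  refine le_trans ?_ (add_le_add (eVariationOn.sum_le (n := p.1) p.2.2.1 p.2.2.2)
    (eVariationOn.sum_le (n := p.1) p.2.2.1 p.2.2.2))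
  rw [← Finset.sum_add_distrib]
  refine Finset.sum_le_sum fun i _ => ?_
  simp only [edist_eq_enorm_sub, Pi.sub_apply]
  rw [sub_sub_sub_comm]
  exact enorm_sub_le

theorem LocallyBoundedVariationOn.sub {α E : Type*} [LinearOrder α] [SeminormedAddCommGroup E]
    {f g : α → E} {s : Set α} (hf : LocallyBoundedVariationOn f s)
    (hg : LocallyBoundedVariationOn g s) : LocallyBoundedVariationOn (f - g) s :=
  fun a b ha hb => ne_top_of_le_ne_top (ENNReal.add_ne_top.2 ⟨hf a b ha hb, hg a b ha hb⟩)
    (eVariationOn.sub_le f g _)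

theorem LocallyBoundedVariationOn.comp_monotone {α β E : Type*} [LinearOrder α] [LinearOrder β]
    [PseudoEMetricSpace E] {f : α → E} (hf : LocallyBoundedVariationOn f univ) {φ : β → α}
    (hφ : Monotone φ) : LocallyBoundedVariationOn (f ∘ φ) univ := fun a b _ _ =>
  ne_top_of_le_ne_top (hf (φ a) (φ b) (mem_univ _) (mem_univ _))
    (eVariationOn.comp_le_of_monotoneOn _ _ (hφ.monotoneOn _)
      fun _ ht => ⟨mem_univ _, hφ ht.2.1, hφ ht.2.2⟩)

theorem measurable_eVariationOn {α : Type*} [LinearOrder α] [Countable α] (s : Set α) :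
    Measurable fun f : α → ℝ => eVariationOn f s := by
  refine LowerSemicontinuous.measurable (lowerSemicontinuous_iSup fun p => ?_)
  refine Continuous.lowerSemicontinuous (continuous_finsetSum _ fun i _ => ?_)
  exact (continuous_apply _).edist (continuous_apply _)

/-! ### Right-continuous extension from rational times -/

/-- The right-continuous extension `t ↦ inf {p q | q > t}` of a function on rational times. -/
noncomputable def rightInf (p : NNRat → ℝ) (t : ℝ≥0) : ℝ := sInf (p '' {q | t < q})

theorem rightInf_le {p : NNRat → ℝ} (hp : Monotone p) {t : ℝ≥0} {q : NNRat} (h : t < q) :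
    rightInf p t ≤ p q :=
  csInf_le ⟨p 0, forall_mem_image.2 fun _ _ => hp zero_le⟩ (mem_image_of_mem p h)

theorem exists_nnrat_gt (t : ℝ≥0) : ∃ q : NNRat, t < q := by
  obtain ⟨n, hn⟩ := exists_nat_gt t
  exact ⟨n, by simpa using hn⟩

theorem le_rightInf {p : NNRat → ℝ} {t : ℝ≥0} {c : ℝ} (h : ∀ q : NNRat, t < q → c ≤ p q) :
    c ≤ rightInf p t :=
  le_csInf (Nonempty.image p (exists_nnrat_gt t)) (forall_mem_image.2 h)

theorem exists_lt_rightInf_add (p : NNRat → ℝ) (t : ℝ≥0) {ε : ℝ} (hε : 0 < ε) :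
    ∃ q : NNRat, t < q ∧ p q < rightInf p t + ε := by
  by_contra! h
  linarith [le_rightInf h]

theorem monotone_rightInf {p : NNRat → ℝ} (hp : Monotone p) : Monotone (rightInf p) :=
  fun _ _ hst => le_rightInf fun _ hq => rightInf_le hp (hst.trans_lt hq)

theorem continuousWithinAt_rightInf {p : NNRat → ℝ} (hp : Monotone p) (t : ℝ≥0) :
    ContinuousWithinAt (rightInf p) (Ici t) t := by
  rw [Metric.continuousWithinAt_iff']
  intro ε hε
  obtain ⟨q, htq, hq⟩ := exists_lt_rightInf_add p t hε
  filter_upwards [self_mem_nhdsWithin, mem_nhdsWithin_of_mem_nhds (Iio_mem_nhds htq)] with s hs hsq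
  have h1 := monotone_rightInf hp (mem_Ici.1 hs)
  have h2 := rightInf_le hp (mem_Iio.1 hsq)
  rw [Real.dist_eq, abs_lt]
  constructor <;> linarith

/-- The functions on rational times that are right continuous along the rational times. -/
def ratRightContinuous : Set (NNRat → ℝ) :=
  {f | ∀ (q : NNRat) (k : ℕ), ∃ r : NNRat, q < r ∧ ∀ s : NNRat, q < s → s < r →
    |f s - f q| ≤ 1 / ((k : ℝ) + 1)}

theorem measurableSet_ratRightContinuous : MeasurableSet ratRightContinuous := by
  simp only [ratRightContinuous, ofPred_exists, ofPred_forall, ofPred_and]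
  refine .iInter fun q => .iInter fun k => .iUnion fun r => (MeasurableSet.const _).inter <|
    .iInter fun s => .iInter fun _ => .iInter fun _ => ?_
  exact measurableSet_le (((measurable_pi_apply s).sub (measurable_pi_apply q)).abs)
    measurable_const

/-- Neither `p` nor `q` need be right continuous at `t`, but their right jumps there cancel because
the difference is. All is compared at one rational `s` slightly after `t`. -/
theorem rightInf_sub_rightInf {p q : NNRat → ℝ} (hp : Monotone p) (hq : Monotone q)
    (h : p - q ∈ ratRightContinuous) (t : NNRat) : rightInf p t - rightInf q t = p t - q t := by
  refine eq_of_forall_dist_le fun ε hε => ?_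
  rw [Real.dist_eq]
  obtain ⟨k, hk⟩ := exists_nat_one_div_lt (half_pos hε)
  obtain ⟨u, htu, hu⟩ := h t k
  obtain ⟨v, htv, hv⟩ := exists_lt_rightInf_add p t (half_pos hε)
  obtain ⟨w, htw, hw⟩ := exists_lt_rightInf_add q t (half_pos hε)
  have htv : t < v := by exact_mod_cast htv
  have htw : t < w := by exact_mod_cast htw
  obtain ⟨s, hts, hs⟩ := exists_between (lt_min htu (lt_min htv htw))
  rw [lt_min_iff, lt_min_iff] at hs
  have h1 := hu s hts hs.1
  have hts' : (t : ℝ≥0) < s := by exact_mod_cast hts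
  have h2 := rightInf_le hp hts'
  have h3 := rightInf_le hq hts'
  have h4 := hp hs.2.1.le
  have h5 := hq hs.2.2.le
  simp only [Pi.sub_apply] at h1
  rw [abs_le] at h1 ⊢
  constructor <;> linarith [h1.1, h1.2]

/-! ### Borel conditions on countable index sets, and transfer of standard Borel structure -/

theorem measurableSet_locallyBoundedVariationOn_univ {α : Type*} [LinearOrder α] [Countable α] :
    MeasurableSet {f : α → ℝ | LocallyBoundedVariationOn f univ} := by
  simp only [LocallyBoundedVariationOn, BoundedVariationOn, ofPred_forall]
  refine .iInter fun a => .iInter fun b => .iInter fun _ => .iInter fun _ => ?_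
  exact (measurable_eVariationOn _ (measurableSet_singleton ⊤)).compl

theorem measurableSet_monotone {α : Type*} [Preorder α] [Countable α] :
    MeasurableSet {f : α → ℝ | Monotone f} := by
  simp only [Monotone, ofPred_forall]
  exact .iInter fun a => .iInter fun b => .iInter fun _ =>
    measurableSet_le (measurable_pi_apply a) (measurable_pi_apply b)

theorem MeasurableEquiv.standardBorelSpace {α β : Type*} [MeasurableSpace α] [MeasurableSpace β]
    [StandardBorelSpace β] (e : α ≃ᵐ β) : StandardBorelSpace α := by
  let := upgradeStandardBorel β
  let : TopologicalSpace α := .induced e inferInstance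
  have : PolishSpace α := (e.toEquiv.toHomeomorphOfIsInducing ⟨rfl⟩).isClosedEmbedding.polishSpace
  refine ⟨inferInstance, ⟨?_⟩, this⟩
  rw [← e.measurableEmbedding.comap_eq]
  refine (congrArg (MeasurableSpace.comap e) (eq_borel_upgradeStandardBorel β)).trans ?_
  exact (borel_comap (f := e)).symm

/-! ### M and BV as standard Borel spaces -/

namespace SkorokhodSpace

theorem ratRestrict_mem_ratRightContinuous (x : SkorokhodSpace ℝ) :
    ratRestrict x ∈ ratRightContinuous := by
  intro q k
  obtain ⟨u, hu, h⟩ := x.exists_pos_forall_abs_sub_lt q (Nat.one_div_pos_of_nat (α := ℝ) (n := k))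
  obtain ⟨r, hqr, hru⟩ := exists_nnrat_btwn hu
  refine ⟨r, by exact_mod_cast hqr, fun s hqs hsr => (h s ?_ ?_).le⟩
  · exact_mod_cast hqs.le
  · refine lt_trans ?_ hru
    exact_mod_cast hsr

theorem exists_ratRestrict_eq {f : NNRat → ℝ} (hf : LocallyBoundedVariationOn f univ)
    (hf' : f ∈ ratRightContinuous) : ∃ x ∈ boundedVariation, ratRestrict x = f := by
  obtain ⟨p, q, hp, hq, rfl⟩ := hf.exists_monotoneOn_sub_monotoneOn
  rw [monotoneOn_univ] at hp hq
  have hP := monotone_rightInf hp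
  have hQ := monotone_rightInf hq
  refine ⟨⟨rightInf p - rightInf q, fun t => (continuousWithinAt_rightInf hp t).sub
    (continuousWithinAt_rightInf hq t), fun t => ⟨_, (hP.tendsto_nhdsLT t).sub
      (hQ.tendsto_nhdsLT t)⟩⟩, ?_, ?_⟩
  · exact (hP.monotoneOn _).locallyBoundedVariationOn.sub
      (hQ.monotoneOn _).locallyBoundedVariationOn
  · exact funext fun t => rightInf_sub_rightInf hp hq hf' t

/-- From rational to all times, partitions need not be compared: the trace extends to some path in
BV, which is the given path by injectivity of `ratRestrict`. -/
theorem locallyBoundedVariationOn_ratRestrict_iff {x : SkorokhodSpace ℝ} :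
    LocallyBoundedVariationOn (ratRestrict x) univ ↔ x ∈ boundedVariation := by
  constructor
  · intro h
    obtain ⟨y, hy, hyx⟩ := exists_ratRestrict_eq h x.ratRestrict_mem_ratRightContinuous
    rwa [← ratRestrict_injective hyx]
  · intro h
    exact LocallyBoundedVariationOn.comp_monotone (φ := fun q : NNRat => (q : ℝ≥0)) h
      NNRat.cast_mono

theorem monotone_ratRestrict_iff {x : SkorokhodSpace ℝ} :
    Monotone (ratRestrict x) ↔ x ∈ nondecreasing := by
  refine ⟨fun h s t hst => ?_, fun h => Monotone.comp h NNRat.cast_mono⟩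
  rcases hst.eq_or_lt with rfl | hst
  · rfl
  by_contra! hlt
  -- A level `c` separates the two values; right continuity finds rationals just after `s` and `t`
  -- on opposite sides of it.
  obtain ⟨c, hc1, hc2⟩ := exists_between hlt
  obtain ⟨q, hsq, hqt, hq⟩ := exists_nnrat_mem_of_isOpen isOpen_Ioi hc2 hst
  obtain ⟨r, htr, -, hr⟩ := exists_nnrat_mem_of_isOpen isOpen_Iio hc1 (lt_add_one t)
  have : q ≤ r := by exact_mod_cast (hqt.trans htr).le
  exact ((h this).trans_lt hr).not_gt hq

theorem nondecreasing_subset_boundedVariation : nondecreasing ⊆ boundedVariation :=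
  fun _ hx => (Monotone.monotoneOn hx _).locallyBoundedVariationOn

theorem measurableSet_boundedVariation : MeasurableSet boundedVariation := by
  convert measurable_ratRestrict measurableSet_locallyBoundedVariationOn_univ using 1
  exact Set.ext fun x => locallyBoundedVariationOn_ratRestrict_iff.symm

theorem measurableSet_nondecreasing : MeasurableSet nondecreasing := by
  convert measurable_ratRestrict measurableSet_monotone using 1
  exact Set.ext fun x => monotone_ratRestrict_iff.symm

theorem measurable_iff_ratRestrict {α : Type*} [MeasurableSpace α] {f : α → SkorokhodSpace ℝ} :
    Measurable f ↔ Measurable (ratRestrict ∘ f) := by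
  rw [← measurable_comap_iff, ← borel_eq_comap_ratRestrict]

theorem standardBorelSpace_boundedVariation : StandardBorelSpace boundedVariation := by
  have hR : MeasurableSet ({f : NNRat → ℝ | LocallyBoundedVariationOn f univ} ∩ ratRightContinuous) :=
    measurableSet_locallyBoundedVariationOn_univ.inter measurableSet_ratRightContinuous
  have := hR.standardBorel
  choose g hg hgr using fun f : ↥({f : NNRat → ℝ | LocallyBoundedVariationOn f univ} ∩
    ratRightContinuous) => exists_ratRestrict_eq f.2.1 f.2.2
  refine MeasurableEquiv.standardBorelSpace
    (β := ↥({f : NNRat → ℝ | LocallyBoundedVariationOn f univ} ∩ ratRightContinuous))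
    { toFun := fun x => ⟨ratRestrict x, locallyBoundedVariationOn_ratRestrict_iff.2 x.2,
        ratRestrict_mem_ratRightContinuous _⟩
      invFun := fun f => ⟨g f, hg f⟩
      left_inv := fun x => Subtype.ext (ratRestrict_injective (hgr _))
      right_inv := fun f => Subtype.ext (hgr f)
      measurable_toFun := (measurable_ratRestrict.comp measurable_subtype_coe).subtype_mk
      measurable_invFun := ?_ }
  refine Measurable.subtype_mk (measurable_iff_ratRestrict.2 ?_)
  convert measurable_subtype_coe using 1
  exact funext hgr

theorem standardBorelSpace_nondecreasing : StandardBorelSpace nondecreasing := by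
  have := standardBorelSpace_boundedVariation
  have hmeas : MeasurableSet (Subtype.val ⁻¹' nondecreasing : Set boundedVariation) :=
    measurable_subtype_coe measurableSet_nondecreasing
  have := hmeas.standardBorel
  exact MeasurableEquiv.standardBorelSpace
    (β := ↥(Subtype.val ⁻¹' nondecreasing : Set boundedVariation))
    { toFun := fun x => ⟨⟨x, nondecreasing_subset_boundedVariation x.2⟩, x.2⟩
      invFun := fun x => ⟨x.1.1, x.2⟩
      left_inv := fun _ => rfl
      right_inv := fun _ => rfl
      measurable_toFun := measurable_subtype_coe.subtype_mk.subtype_mk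
      measurable_invFun := (measurable_subtype_coe.comp measurable_subtype_coe).subtype_mk }

/-! ### Stopping, gluing and completeness -/

theorem measurable_stopAt (t : ℝ≥0) : Measurable (stopAt t : SkorokhodSpace ℝ → _) :=
  measurable_iff_ratRestrict.2 <| measurable_pi_lambda _ fun q => measurable_eval (min (q : ℝ≥0) t)

theorem stopAt_stopAt {E : Type*} [MetricSpace E] (s t : ℝ≥0) (x : SkorokhodSpace E) :
    stopAt s (stopAt t x) = stopAt (min s t) x :=
  SkorokhodSpace.ext (funext fun u => congrArg x (min_assoc u s t))

/-- The path that agrees with `x t` at time `t`, for a family of paths `x t` such that `x s` is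
`x t` stopped at `s` whenever `s ≤ t`. -/
def glue {E : Type*} [MetricSpace E] (x : ℝ≥0 → SkorokhodSpace E)
    (hx : ∀ s t, s ≤ t → stopAt s (x t) = x s) : SkorokhodSpace E where
  toFun t := x t t
  right_continuous t := by
    -- `x t` is frozen after time `t`, so right continuity is read off from `x (t + 1)`.
    have key (s : ℝ≥0) (hs : s ≤ t + 1) : x (t + 1) s = x s s := by
      rw [← hx s _ hs]; exact congrArg (x (t + 1)) (min_self s).symm
    refine ((x (t + 1)).right_continuous t).congr_of_eventuallyEq ?_
      (key t (lt_add_one t).le).symm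
    filter_upwards [mem_nhdsWithin_of_mem_nhds (Iic_mem_nhds (lt_add_one t))] with s hs
    exact (key s hs).symm
  left_limits t := by
    obtain ⟨l, hl⟩ := (x t).left_limits t
    refine ⟨l, hl.congr' ?_⟩
    filter_upwards [self_mem_nhdsWithin] with s hs
    rw [← hx s t (le_of_lt hs)]
    exact congrArg (x t) (min_self s).symm

theorem stopAt_glue {E : Type*} [MetricSpace E] (x : ℝ≥0 → SkorokhodSpace E)
    (hx : ∀ s t, s ≤ t → stopAt s (x t) = x s) (t : ℝ≥0) : stopAt t (glue x hx) = x t := by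
  ext s
  have h1 := congrArg (fun y : SkorokhodSpace E => y (min s t)) (hx (min s t) t (min_le_right s t))
  have h2 := congrArg (fun y : SkorokhodSpace E => y s) (hx t t le_rfl)
  simp only [stopAt, min_self] at h1 h2
  exact h1.symm.trans h2

/-- Injectivity holds since `x t` is the value at `t` of `x` stopped at `t`; surjectivity is gluing,
and `h'` puts the glued path back into `A`. -/
theorem isCompleteFiltratedBorelSpace_restrict {A : Set (SkorokhodSpace ℝ)}
    (hA : StandardBorelSpace A) (h : ∀ t, MapsTo (stopAt t) A A)
    (h' : ∀ x, (∀ t, stopAt t x ∈ A) → x ∈ A) :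
    IsCompleteFiltratedBorelSpace fun t => (h t).restrict := by
  have hθ : IsFiltratedBorelSpace fun t => (h t).restrict :=
    { standardBorel := hA
      measurable := fun t => ((measurable_stopAt t).comp measurable_subtype_coe).subtype_mk
      comp_eq := fun s t => funext fun x => Subtype.ext <|
        (stopAt_stopAt t s x.1).trans (by rw [min_comm]; rfl) }
  refine ⟨hθ, fun x y hxy => ?_, fun e => ?_⟩
  · ext t
    have h1 : stopAt t x.1 = stopAt t y.1 :=
      congrArg (fun e : hθ.projLimit => ((e.1 t).1 : SkorokhodSpace ℝ)) hxy
    simpa [stopAt] using congrArg (fun z : SkorokhodSpace ℝ => z t) h1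
  · have hx (s t : ℝ≥0) (hst : s ≤ t) : stopAt s ((e.1 t).1 : SkorokhodSpace ℝ) = (e.1 s).1 := by
      rcases hst.eq_or_lt with rfl | hst
      · exact congrArg Subtype.val (e.1 s).2
      · exact congrArg (fun z => (z.1 : SkorokhodSpace ℝ)) (e.2 s t hst)
    have hs := stopAt_glue (fun t => ((e.1 t).1 : SkorokhodSpace ℝ)) hx
    refine ⟨⟨glue _ hx, h' _ fun t => by rw [hs]; exact (e.1 t).1.2⟩, ?_⟩
    exact Subtype.ext <| funext fun t => Subtype.ext <| Subtype.ext (hs t)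

theorem mapsTo_stopAt_nondecreasing (t : ℝ≥0) : MapsTo (stopAt t) nondecreasing nondecreasing :=
  fun _ hx _ _ h => hx (min_le_min_right t h)

theorem mapsTo_stopAt_boundedVariation (t : ℝ≥0) :
    MapsTo (stopAt t) boundedVariation boundedVariation :=
  fun _ hx => LocallyBoundedVariationOn.comp_monotone (φ := fun s => min s t) hx
    fun _ _ h => min_le_min_right t h

theorem mem_nondecreasing_of_forall_stopAt {x : SkorokhodSpace ℝ}
    (h : ∀ t, stopAt t x ∈ nondecreasing) : x ∈ nondecreasing := by
  intro s t hst
  simpa [stopAt, hst] using h t hst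

theorem mem_boundedVariation_of_forall_stopAt {x : SkorokhodSpace ℝ}
    (h : ∀ t, stopAt t x ∈ boundedVariation) : x ∈ boundedVariation := by
  intro a b ha hb
  have := h b a b ha hb
  rwa [BoundedVariationOn, eVariationOn.congr (g := x.toFun)] at this
  intro s hs
  exact congrArg x (min_eq_left hs.2.2)

end SkorokhodSpace

theorem mainTheorem5 :
    (MeasurableSet SkorokhodSpace.nondecreasing ∧
      MeasurableSet SkorokhodSpace.boundedVariation) ∧
    (∃ h : ∀ t, MapsTo (SkorokhodSpace.stopAt t) SkorokhodSpace.nondecreasing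
        SkorokhodSpace.nondecreasing,
      IsCompleteFiltratedBorelSpace fun t => (h t).restrict) ∧
    (∃ h : ∀ t, MapsTo (SkorokhodSpace.stopAt t) SkorokhodSpace.boundedVariation
        SkorokhodSpace.boundedVariation,
      IsCompleteFiltratedBorelSpace fun t => (h t).restrict) :=
  ⟨⟨SkorokhodSpace.measurableSet_nondecreasing, SkorokhodSpace.measurableSet_boundedVariation⟩,
    ⟨SkorokhodSpace.mapsTo_stopAt_nondecreasing,
      SkorokhodSpace.isCompleteFiltratedBorelSpace_restrict
        SkorokhodSpace.standardBorelSpace_nondecreasing _ fun _ =>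
          SkorokhodSpace.mem_nondecreasing_of_forall_stopAt⟩,
    SkorokhodSpace.mapsTo_stopAt_boundedVariation,
    SkorokhodSpace.isCompleteFiltratedBorelSpace_restrict
      SkorokhodSpace.standardBorelSpace_boundedVariation _ fun _ =>
        SkorokhodSpace.mem_boundedVariation_of_forall_stopAt⟩
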